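/- Let $q$ be a power of the prime $p$ and let $\mathcal T$ be a (finite) multiset of points of $\mathrm{AG}(2,q)\subset\mathrm{PG}(2,q)$. A direction is a point $(d)$ of the line at infinity; the affine lines with direction $(d)$ are the $q$ lines through $(d)$ other than the line at infinity, and the intersection number of a line is the number of points of $\mathcal T$ on it, counted with multiplicity. Let $0\le\lambda\le (q-1)/2$ be an integer. A direction $(d)$ is called $(q-\lambda)$-uniform if at least $q-\lambda$ affine lines with direction $(d)$ have the same intersection number modulo $p$; this residue, which is then unique, is the typical intersection number $m_d$, and the remaining affine lines with direction $(d)$ are called renitent. An algebraic envelope of class $n$ is a curve of degree $n$ in the dual plane, given by a nonzero homogeneous polynomial $G\in\mathbb F_q[X,Y,Z]$ of degree $n$; it contains the line $[a:b:c]$ if $G(a,b,c)=0$. Its intersection multiplicity with the pencil centred at a point $P$ at a line $\ell\ni P$ is the order of vanishing at $t=0$ of $G(\ell+t\ell')$, where $\ell'\neq \ell$ is any other line through $P$ (lines being represented by coordinate vectors). **Theorem.** Let $\mathcal F_\lambda$ be a set of $(q-\lambda)$-uniform directions (possibly all $q+1$ directions). For each $(d)\in\mathcal F_\lambda$ let $\ell_{d,1},\dots,\ell_{d,\lambda_d}$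 be the renitent lines with direction $(d)$, let $t_{d,1},\dots,t_{d,\lambda_d}$ be their intersection numbers, and assume $0<\lambda_d$ (necessarily $\lambda_d\le\lambda$). Let $c\in\mathbb F_p\setminus\{0\}$ and let $\lambda_{d,i}(c)\in\{1,\dots,p-1\}$ be the integers with $$c\,\lambda_{d,i}(c)\equiv t_{d,i}-m_d \pmod p .$$ Assume that $$\Lambda_d(c):=\sum_{i=1}^{\lambda_d}\lambda_{d,i}(c)\le\min\{q-2,\,p-1\}$$ for each $(d)\in\mathcal F_\lambda$, where the sum is taken over the natural numbers. Then $\Lambda(c):=\Lambda_d(c)$ does not depend on $(d)\in\mathcal F_\lambda$, and there is an algebraic envelope of class $\Lambda(c)$ that contains all renitent lines with direction in $\mathcal F_\lambda$ and whose intersection multiplicity with the pencil centred at $(d)$ at the line $\ell_{d,i}$ is $\lambda_{d,i}(c)$, for every $(d)\in\mathcal F_\lambda$ and $1\le i\le\lambda_d$. -/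

import Mathlib

open scoped LinearAlgebra.Projectivization

namespace RenitentLines

/-- Points `(x : y : z)` of the projective plane `PG(2,K)`. -/
abbrev Point (K : Type*) [Field K] := ℙ K (Fin 3 → K)

/-- Lines `[a : b : c]` of `PG(2,K)`, that is, points of the dual plane.  Mathlib's incidence
`P ∈ ℓ` (in `Configuration.ofField`) is `a * x + b * y + c * z = 0`. -/
abbrev Line (K : Type*) [Field K] := ℙ K (Fin 3 → K)

variable {K : Type*} [Field K]

/-- The line at infinity `[0 : 0 : 1]`. -/
def lineAtInfinity (K : Type*) [Field K] : Line K :=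
  Projectivization.mk K ![0, 0, 1] (fun h => one_ne_zero (congrFun h 2))

/-- The point `(a, b)` of `AG(2,K)`, seen as the point `(a : b : 1)` of `PG(2,K)`. -/
def affinePoint (P : K × K) : Point K :=
  Projectivization.mk K ![P.1, P.2, 1] (fun h => one_ne_zero (congrFun h 2))

/-- The parallel class of the direction `d`: the affine lines through the point `d`
(meant for points `d` of the line at infinity). -/
def affineLines (d : Point K) : Set (Line K) :=
  {ℓ | d ∈ ℓ ∧ ℓ ≠ lineAtInfinity K}

open Classical in
/-- The number of points of the multiset `T`, with multiplicity, on the line `ℓ`. -/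
noncomputable def intersectionNumber (T : Multiset (K × K)) (ℓ : Line K) : ℕ :=
  T.countP (fun P => affinePoint P ∈ ℓ)

/-- At least `k` affine lines with direction `d` meet `T` in `m` points modulo `p`.
For `k = q - lam` with `lam ≤ (q - 1) / 2`, at most one `m` has this property. -/
def IsTypicalNumber (p : ℕ) (T : Multiset (K × K)) (k : ℕ) (d : Point K) (m : ZMod p) : Prop :=
  k ≤ Set.ncard {ℓ ∈ affineLines d | (intersectionNumber T ℓ : ZMod p) = m}

/-- `d` is a `k`-uniform direction: a point at infinity such that at least `k` affine lines
through it meet `T` in the same number of points modulo `p`. -/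
def IsUniformDirection (p : ℕ) (T : Multiset (K × K)) (k : ℕ) (d : Point K) : Prop :=
  d ∈ lineAtInfinity K ∧ ∃ m : ZMod p, IsTypicalNumber p T k d m

/-- The renitent lines with direction `d`, where `m` is the typical intersection number at `d`. -/
def renitentLines (p : ℕ) (T : Multiset (K × K)) (d : Point K) (m : ZMod p) : Set (Line K) :=
  {ℓ ∈ affineLines d | (intersectionNumber T ℓ : ZMod p) ≠ m}

/-- An algebraic envelope of class `n`: a curve of degree `n` in the dual plane, given by a
nonzero homogeneous polynomial of degree `n` in the line coordinates. -/
structure AlgebraicEnvelope (K : Type*) [Field K] (n : ℕ) where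
  form : MvPolynomial (Fin 3) K
  ne_zero : form ≠ 0
  isHomogeneous : form.IsHomogeneous n

/-- The line `ℓ` belongs to the envelope (by homogeneity the choice of line coordinates is
irrelevant). -/
def AlgebraicEnvelope.Contains {n : ℕ} (E : AlgebraicEnvelope K n) (ℓ : Line K) : Prop :=
  MvPolynomial.eval ℓ.rep E.form = 0

/-- The restriction of the form of the envelope to the dual line through `ℓ` and `ℓ'`,
i.e. to the pencil spanned by these two lines, as the univariate polynomial
`G (ℓ + t • ℓ')` in the parameter `t`; `t = 0` is the line `ℓ`. -/
noncomputable def AlgebraicEnvelope.restrict {n : ℕ} (E : AlgebraicEnvelope K n)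
    (ℓ ℓ' : Line K) : Polynomial K :=
  MvPolynomial.aeval
    (fun i => Polynomial.C (ℓ.rep i) + Polynomial.X * Polynomial.C (ℓ'.rep i)) E.form

/-- The intersection multiplicity at the line `ℓ` of the envelope with the pencil centred at `P`
is `k`: the pencil contains `ℓ`, and the form of the envelope, restricted to the pencil, vanishes
at `ℓ` to order exactly `k`.  The order does not depend on the second line `ℓ'` of the pencil that
is used to parametrize it; it is infinite if the pencil is contained in the envelope as a component,
and then no natural number `k` qualifies. -/
def AlgebraicEnvelope.HasPencilMultiplicity {n : ℕ} (E : AlgebraicEnvelope K n)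
    (P : Point K) (ℓ : Line K) (k : ℕ) : Prop :=
  P ∈ ℓ ∧ ∀ ℓ' : Line K, P ∈ ℓ' → ℓ' ≠ ℓ →
    emultiplicity Polynomial.X (E.restrict ℓ ℓ') = (k : ℕ∞)

end RenitentLines

/-! Fix a direction whose affine lines are `α x + β y = s`, and give each renitent line the weight
`W s = w ℓ`, every other line weight 0. Sorting the points `(a, b)` of `T` by these lines turns `∑
(α a + β b) ^ k` into `∑ N_s s ^ k`, with `N_s` the intersection numbers. Since `∑ s ^ k = 0` for `k
< q - 1`, subtracting the typical number changes nothing, and division by `c` leaves `∑ W s * s ^ k`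
(`inv_mul_sum_map_pow_eq`). Thus one form in `X, Y`, independent of the direction, specialises at
`(α, β)` to the `k`-th power sum of the weighted renitent lines. The case `k = 0` shows that the
total weight is `|T| / c` modulo `p`; being at most `p - 1`, it is the same number `n` for all
directions. As `n < p`, Newton's identities turn the power sums into forms `σ_k` of degree `k`, and
`G = ∑ σ_k Z ^ (n - k)` restricts to each pencil as `∏ (Z + s) ^ W s` (`aeval_envelopeForm`). Its
zeros are the lines `[α : β : -s]` with the required multiplicities. -/

namespace RenitentLines

open Finset

/-! ### Newton's identities below the characteristic -/

section Newton

variable {K A B : Type*} [Field K] [CommRing A] [Algebra K A] [CommRing B] [Algebra K B]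

/-- The elements determined by the sequence `π` through Newton's recursion; when `π` is the
sequence of power sums of a family, these are the elementary symmetric functions of the family,
in degrees that are smaller than the characteristic. -/
noncomputable def newtonESymm (K : Type*) {A : Type*} [Field K] [CommRing A] [Algebra K A]
    (π : ℕ → A) : ℕ → A
  | 0 => 1
  | k + 1 => algebraMap K A (((k + 1 : ℕ) : K)⁻¹ * (-1) ^ k) *
      ∑ i : Fin (k + 1), (-1) ^ (i : ℕ) * newtonESymm K π i * π (k + 1 - i)

/-- The recursion uses only ring operations and scalars of `K`. This lets the universal forms in `X,
Y` be specialised to a pencil. -/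
lemma map_newtonESymm (φ : A →ₐ[K] B) (π : ℕ → A) (k : ℕ) :
    φ (newtonESymm K π k) = newtonESymm K (fun j => φ (π j)) k := by
  induction k using Nat.strong_induction_on with
  | _ k ih =>
    cases k with
    | zero => simp [newtonESymm]
    | succ k =>
      rw [newtonESymm, newtonESymm, map_mul, AlgHom.commutes, map_sum]
      congr 1
      refine Finset.sum_congr rfl fun i _ => ?_
      rw [map_mul, map_mul, ih i i.2]
      simp

lemma isHomogeneous_newtonESymm {σ : Type*} {π : ℕ → MvPolynomial σ K}
    (hπ : ∀ j, (π j).IsHomogeneous j) (k : ℕ) : (newtonESymm K π k).IsHomogeneous k := by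
  induction k using Nat.strong_induction_on with
  | _ k ih =>
    cases k with
    | zero => simpa [newtonESymm] using MvPolynomial.isHomogeneous_one σ K
    | succ k =>
      rw [newtonESymm, MvPolynomial.algebraMap_eq]
      refine MvPolynomial.IsHomogeneous.C_mul (MvPolynomial.IsHomogeneous.sum _ _ _ fun i _ => ?_) _
      have hi : (i : ℕ) + (k + 1 - i) = k + 1 := by omega
      have h1 : ((-1 : MvPolynomial σ K) ^ (i : ℕ)) = MvPolynomial.C ((-1) ^ (i : ℕ)) := by simp
      rw [h1]
      have := ((ih i i.2).C_mul ((-1) ^ (i : ℕ))).mul (hπ (k + 1 - i))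
      rwa [hi] at this

lemma newtonESymm_eq_aeval_esymm {σ : Type*} [Fintype σ] (z : σ → A) {π : ℕ → A} {n : ℕ}
    (hn : ∀ k, k < n → ((k + 1 : ℕ) : K) ≠ 0) (hπ : ∀ k ≤ n, π k = ∑ i, z i ^ k)
    {k : ℕ} (hk : k ≤ n) :
    newtonESymm K π k = MvPolynomial.aeval z (MvPolynomial.esymm σ K k) := by
  induction k using Nat.strong_induction_on with
  | _ k ih =>
    cases k with
    | zero => simp [newtonESymm]
    | succ k =>
      have hne := hn k (by omega)
      have newton := congrArg (MvPolynomial.aeval z) (MvPolynomial.mul_esymm_eq_sum σ K (k + 1))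
      rw [Finset.sum_filter, Finset.Nat.sum_antidiagonal_eq_sum_range_succ_mk,
        Finset.sum_range_succ] at newton
      simp only [lt_irrefl, if_false, add_zero, map_mul, map_natCast, map_pow, map_neg, map_one,
        map_sum] at newton
      have hsum : ∑ i : Fin (k + 1), (-1) ^ (i : ℕ) * newtonESymm K π i * π (k + 1 - i) =
          ∑ i ∈ Finset.range (k + 1), MvPolynomial.aeval z
            (if i < k + 1 then (-1) ^ i * MvPolynomial.esymm σ K i *
              MvPolynomial.psum σ K (k + 1 - i) else 0) := by
        rw [← Fin.sum_univ_eq_sum_range (fun i => MvPolynomial.aeval z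
            (if i < k + 1 then (-1) ^ i * MvPolynomial.esymm σ K i *
              MvPolynomial.psum σ K (k + 1 - i) else 0))]
        refine Finset.sum_congr rfl fun i _ => ?_
        rw [if_pos i.2, ih i i.2 (by omega), hπ _ (by omega)]
        simp [MvPolynomial.psum]
      rw [newtonESymm, hsum, map_mul, mul_assoc]
      -- Mathlib's identity for degree `k + 1` carries the sign `(-1) ^ (k + 2)`.
      have h2 : (algebraMap K A) ((-1) ^ k) = (-1) ^ (k + 1 + 1) := by
        simp [pow_succ]
      rw [h2, ← newton, ← map_natCast (algebraMap K A), ← mul_assoc, ← map_mul,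
        inv_mul_cancel₀ hne, map_one, one_mul]

lemma prod_add_eq_sum_aeval_esymm {σ : Type*} [Fintype σ] (z : σ → A) (a : A) :
    ∏ i, (a + z i) = ∑ k ∈ Finset.range (Fintype.card σ + 1),
      MvPolynomial.aeval z (MvPolynomial.esymm σ K k) * a ^ (Fintype.card σ - k) := by
  classical
  simp_rw [add_comm a]
  rw [Finset.prod_add, Finset.sum_powerset, Finset.card_univ]
  refine Finset.sum_congr rfl fun k _ => ?_
  rw [MvPolynomial.esymm, map_sum, Finset.sum_mul]
  refine Finset.sum_congr rfl fun t ht => ?_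
  rw [Finset.mem_powersetCard] at ht
  rw [map_prod, Finset.prod_const, Finset.card_sdiff_of_subset ht.1, ht.2, Finset.card_univ]
  simp

/-- Multiplicities are removed by repeating `z i` over the index type `Σ i, Fin (W i)`; then this is
Vieta's formula. -/
lemma prod_add_pow_eq_sum_newtonESymm {ι : Type*} [Fintype ι] (z : ι → A) (W : ι → ℕ)
    {π : ℕ → A} (hn : ∀ k, k < ∑ i, W i → ((k + 1 : ℕ) : K) ≠ 0)
    (hπ : ∀ k ≤ ∑ i, W i, π k = ∑ i, (W i : A) * z i ^ k) (a : A) :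
    ∑ k ∈ Finset.range (∑ i, W i + 1), newtonESymm K π k * a ^ (∑ i, W i - k) =
      ∏ i, (a + z i) ^ W i := by
  have hcard : Fintype.card (Σ i, Fin (W i)) = ∑ i, W i := by simp
  have h := prod_add_eq_sum_aeval_esymm (K := K) (fun x : Σ i, Fin (W i) => z x.1) a
  rw [Fintype.prod_sigma, hcard] at h
  simp only [Finset.prod_const, Finset.card_univ, Fintype.card_fin] at h
  rw [h]
  refine Finset.sum_congr rfl fun k hk => ?_
  rw [newtonESymm_eq_aeval_esymm (fun x : Σ i, Fin (W i) => z x.1) hn _ (Nat.lt_succ_iff.mp (Finset.mem_range.mp hk))]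
  intro j hj
  rw [hπ j hj, Fintype.sum_sigma]
  simp

end Newton

variable {K : Type*} [Field K]

/-! ### The form that defines the envelope -/

section Form

/-- The `k`-th power sum of the linear forms `a X + b Y`, for `(a, b)` in `T`, divided by `c`. -/
noncomputable def powerSumForm (T : Multiset (K × K)) (c : K) (k : ℕ) : MvPolynomial (Fin 3) K :=
  MvPolynomial.C c⁻¹ * (T.map fun P =>
    (MvPolynomial.X 0 * MvPolynomial.C P.1 + MvPolynomial.X 1 * MvPolynomial.C P.2) ^ k).sum

/-- The form of degree `n` whose coefficients, as a polynomial in `Z`, arise from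
`powerSumForm T c` through Newton's identities. -/
noncomputable def envelopeForm (T : Multiset (K × K)) (c : K) (n : ℕ) : MvPolynomial (Fin 3) K :=
  ∑ k ∈ Finset.range (n + 1), newtonESymm K (powerSumForm T c) k * MvPolynomial.X 2 ^ (n - k)

lemma isHomogeneous_powerSumForm (T : Multiset (K × K)) (c : K) (k : ℕ) :
    (powerSumForm T c k).IsHomogeneous k := by
  refine MvPolynomial.IsHomogeneous.C_mul ?_ _
  induction T using Multiset.induction_on with
  | empty => simpa using MvPolynomial.isHomogeneous_zero (Fin 3) K k
  | cons P T ih =>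
    rw [Multiset.map_cons, Multiset.sum_cons]
    refine MvPolynomial.IsHomogeneous.add ?_ ih
    have h := (((MvPolynomial.isHomogeneous_X K (0 : Fin 3)).mul
      (MvPolynomial.isHomogeneous_C (Fin 3) P.1)).add
      ((MvPolynomial.isHomogeneous_X K (1 : Fin 3)).mul
      (MvPolynomial.isHomogeneous_C (Fin 3) P.2))).pow k
    simpa using h

lemma isHomogeneous_envelopeForm (T : Multiset (K × K)) (c : K) (n : ℕ) :
    (envelopeForm T c n).IsHomogeneous n := by
  refine MvPolynomial.IsHomogeneous.sum _ _ _ fun k hk => ?_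
  have h := (isHomogeneous_newtonESymm (isHomogeneous_powerSumForm T c) k).mul
    ((MvPolynomial.isHomogeneous_X K (2 : Fin 3)).pow (n - k))
  rw [one_mul, Nat.add_sub_cancel' (Nat.lt_succ_iff.mp (Finset.mem_range.mp hk))] at h
  exact h

/-- Scaling `(α, β)` by `b` multiplies the `k`-th power sum by `b ^ k`, so the roots `y` become `b
y`. The algebra `A` is arbitrary in order to cover both values at a line (`A = K`) and restrictions
to a pencil (`A = K[X]`). -/
lemma aeval_envelopeForm [Fintype K] {A : Type*} [CommRing A] [Algebra K A]
    {T : Multiset (K × K)} {c α β : K} {W : K → ℕ}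
    (hn : ∀ k, k < ∑ y, W y → ((k + 1 : ℕ) : K) ≠ 0)
    (hpow : ∀ k ≤ ∑ y, W y,
      c⁻¹ * (T.map fun P => (α * P.1 + β * P.2) ^ k).sum = ∑ y, (W y : K) * y ^ k)
    (b : A) (v : Fin 3 → A) (h0 : v 0 = b * algebraMap K A α) (h1 : v 1 = b * algebraMap K A β) :
    MvPolynomial.aeval v (envelopeForm T c (∑ y, W y)) =
      ∏ y, (v 2 + b * algebraMap K A y) ^ W y := by
  rw [← prod_add_pow_eq_sum_newtonESymm (K := K) (fun y => b * algebraMap K A y) W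
    (π := fun j => MvPolynomial.aeval v (powerSumForm T c j)) hn, envelopeForm, map_sum]
  · refine Finset.sum_congr rfl fun k _ => ?_
    rw [map_mul, map_newtonESymm, map_pow, MvPolynomial.aeval_X]
  · intro k hk
    have h := congrArg (fun x => b ^ k * algebraMap K A x) (hpow k hk)
    simp only [map_mul, map_sum, Finset.mul_sum] at h
    calc _ = b ^ k * (algebraMap K A c⁻¹ *
          algebraMap K A (T.map fun P => (α * P.1 + β * P.2) ^ k).sum) := by
          rw [powerSumForm, map_mul, MvPolynomial.aeval_C, mul_left_comm]
          congr 1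
          rw [map_multiset_sum, map_multiset_sum, ← Multiset.sum_map_mul_left, Multiset.map_map,
            Multiset.map_map]
          · simp only [Function.comp_apply, ← mul_pow, map_pow, map_add, map_mul,
              MvPolynomial.aeval_X, MvPolynomial.aeval_C, h0, h1, mul_add, mul_assoc]
      _ = _ := by
          rw [h]
          refine Finset.sum_congr rfl fun y _ => ?_
          simp only [map_natCast, map_pow]
          ring

end Form

/-! ### Coordinates on a parallel class -/

section Pencil

/-- The affine line `α x + β y = s`. -/
def affineLine (α β : K) (h : α ≠ 0 ∨ β ≠ 0) (s : K) : Line K :=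
  Projectivization.mk K ![α, β, -s] fun h' =>
    h.elim (fun h => h (congrFun h' 0)) fun h => h (congrFun h' 1)

lemma affinePoint_mem_affineLine {α β : K} (h : α ≠ 0 ∨ β ≠ 0) {s : K} {P : K × K} :
    affinePoint P ∈ affineLine α β h s ↔ α * P.1 + β * P.2 = s := by
  rw [Configuration.ofField.mem_iff, affinePoint, affineLine, Projectivization.orthogonal_mk]
  simp only [Matrix.vec3_dotProduct, Matrix.cons_val]
  constructor <;> intro h <;> linear_combination h

lemma eq_affineLine {α β : K} (h : α ≠ 0 ∨ β ≠ 0) {ℓ : Line K} {u s : K}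
    (h0 : ℓ.rep 0 = u * α) (h1 : ℓ.rep 1 = u * β) (h2 : ℓ.rep 2 = u * -s) :
    ℓ = affineLine α β h s := by
  rw [← ℓ.mk_rep, affineLine, Projectivization.mk_eq_mk_iff']
  refine ⟨u, funext fun i => ?_⟩
  fin_cases i <;> simp [h0, h1, h2]

lemma exists_rep_affineLine {α β : K} (h : α ≠ 0 ∨ β ≠ 0) (s : K) :
    ∃ u : K, u ≠ 0 ∧ (affineLine α β h s).rep 0 = u * α ∧ (affineLine α β h s).rep 1 = u * β ∧
      (affineLine α β h s).rep 2 = u * -s := by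
  obtain ⟨u, hu⟩ := Projectivization.exists_smul_eq_mk_rep K ![α, β, -s] fun h' =>
    h.elim (fun h => h (congrFun h' 0)) fun h => h (congrFun h' 1)
  refine ⟨u, u.ne_zero, ?_⟩
  rw [affineLine, ← hu]
  simp [Units.smul_def]

lemma affineLine_injective {α β : K} (h : α ≠ 0 ∨ β ≠ 0) :
    Function.Injective (affineLine α β h) := by
  intro s t hst
  rw [affineLine, affineLine, Projectivization.mk_eq_mk_iff'] at hst
  obtain ⟨a, ha⟩ := hst
  have h0 : a * α = α := by simpa using congrFun ha 0
  have h1 : a * β = β := by simpa using congrFun ha 1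
  have h2 : a * t = s := by simpa using congrFun ha 2
  have : a = 1 := by
    rcases h with h | h
    · exact (mul_eq_right₀ h).mp h0
    · exact (mul_eq_right₀ h).mp h1
  rw [← h2, this, one_mul]

/-- Coordinates for the pencil centred at a point of the line at infinity. -/
lemma exists_pencil_coordinates {d : Point K} (hd : d ∈ lineAtInfinity K) :
    ∃ (α β : K) (h : α ≠ 0 ∨ β ≠ 0),
      (∀ ℓ : Line K, d ∈ ℓ ↔ ∃ u, ℓ.rep 0 = u * α ∧ ℓ.rep 1 = u * β) ∧
      affineLines d = Set.range (affineLine α β h) := by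
  have hd2 : d.rep 2 = 0 := by
    rw [← d.mk_rep, Configuration.ofField.mem_iff, lineAtInfinity,
      Projectivization.orthogonal_mk] at hd
    simpa only [Matrix.vec3_dotProduct, Matrix.cons_val, mul_zero, mul_one, zero_add] using hd
  have hne : -d.rep 1 ≠ 0 ∨ d.rep 0 ≠ 0 := by
    by_contra! h
    refine d.rep_nonzero (funext fun i => ?_)
    fin_cases i
    · exact h.2
    · exact neg_eq_zero.mp h.1
    · exact hd2
  have hmem : ∀ ℓ : Line K, d ∈ ℓ ↔ d.rep 0 * ℓ.rep 0 + d.rep 1 * ℓ.rep 1 = 0 := fun ℓ => by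
    conv_lhs => rw [← d.mk_rep, ← ℓ.mk_rep, Configuration.ofField.mem_iff,
      Projectivization.orthogonal_mk]
    simp [Matrix.vec3_dotProduct, hd2]
  have hmem' : ∀ ℓ : Line K, d ∈ ℓ ↔
      ∃ u, ℓ.rep 0 = u * -d.rep 1 ∧ ℓ.rep 1 = u * d.rep 0 := fun ℓ => by
    rw [hmem]
    constructor
    · intro h
      rcases hne with h1 | h0
      · refine ⟨ℓ.rep 0 / -d.rep 1, (div_mul_cancel₀ _ h1).symm, ?_⟩
        rw [div_mul_eq_mul_div, eq_div_iff h1]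
        linear_combination -h
      · refine ⟨ℓ.rep 1 / d.rep 0, ?_, (div_mul_cancel₀ _ h0).symm⟩
        rw [div_mul_eq_mul_div, eq_div_iff h0]
        linear_combination h
    · rintro ⟨u, h0, h1⟩
      rw [h0, h1]
      ring
  refine ⟨-d.rep 1, d.rep 0, hne, hmem', Set.ext fun ℓ => ⟨?_, ?_⟩⟩
  · rintro ⟨hℓ, hinf⟩
    obtain ⟨u, h0, h1⟩ := (hmem' ℓ).mp hℓ
    -- The scalar `u` vanishes only for the line at infinity.
    have hu : u ≠ 0 := by
      rintro rfl
      refine hinf ?_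
      rw [← ℓ.mk_rep, lineAtInfinity, Projectivization.mk_eq_mk_iff']
      refine ⟨ℓ.rep 2, funext fun i => ?_⟩
      fin_cases i <;> simp [h0, h1]
    exact ⟨-(ℓ.rep 2 / u), (eq_affineLine hne h0 h1 (by field_simp)).symm⟩
  · rintro ⟨s, rfl⟩
    obtain ⟨u, -, h0, h1, -⟩ := exists_rep_affineLine hne s
    refine ⟨(hmem' _).mpr ⟨u, h0, h1⟩, fun h => ?_⟩
    rw [affineLine, lineAtInfinity, Projectivization.mk_eq_mk_iff'] at h
    obtain ⟨a, ha⟩ := h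
    rcases hne with h' | h'
    · exact h' (by simpa using (congrFun ha 0).symm)
    · exact h' (by simpa using (congrFun ha 1).symm)

end Pencil

/-! ### Power sums of the weighted renitent lines -/

section PowerSums

lemma sum_map_pow_eq_sum_intersectionNumber [Fintype K] (T : Multiset (K × K)) {α β : K}
    (h : α ≠ 0 ∨ β ≠ 0) (k : ℕ) :
    (T.map fun P => (α * P.1 + β * P.2) ^ k).sum =
      ∑ s, (intersectionNumber T (affineLine α β h s) : K) * s ^ k := by
  classical
  induction T using Multiset.induction_on with
  | empty => simp [intersectionNumber]
  | cons P T ih =>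
    simp only [intersectionNumber] at ih
    simp only [Multiset.map_cons, Multiset.sum_cons, ih, intersectionNumber,
      Multiset.countP_cons, affinePoint_mem_affineLine, Nat.cast_add, add_mul,
      Finset.sum_add_distrib]
    simp [add_comm]

open Classical in
/-- The weight of the renitent line `α x + β y = s`, and `0` for the other parallel lines. -/
noncomputable def pencilWeight (R : Set (Line K)) (w : Line K → ℕ) (α β : K)
    (h : α ≠ 0 ∨ β ≠ 0) (s : K) : ℕ :=
  if affineLine α β h s ∈ R then w (affineLine α β h s) else 0

lemma finsum_eq_sum_pencilWeight [Fintype K] {R : Set (Line K)} {w : Line K → ℕ} {α β : K}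
    (h : α ≠ 0 ∨ β ≠ 0) (hR : R ⊆ Set.range (affineLine α β h)) :
    ∑ᶠ ℓ ∈ R, w ℓ = ∑ s, pencilWeight R w α β h s := by
  classical
  rw [← Set.image_preimage_eq_of_subset hR,
    finsum_mem_image (affineLine_injective h).injOn, finsum_mem_def, finsum_eq_sum_of_fintype]
  refine Finset.sum_congr rfl fun s _ => ?_
  rw [Set.image_preimage_eq_of_subset hR, Set.indicator_apply, pencilWeight]
  rfl

lemma inv_mul_sum_map_pow_eq [Fintype K] {p : ℕ} [Fact p.Prime] [CharP K p]
    {T : Multiset (K × K)} {d : Point K} {m c : ZMod p} (hc : c ≠ 0) {w : Line K → ℕ}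
    (hw : ∀ ℓ ∈ renitentLines p T d m,
      c * (w ℓ : ZMod p) = (intersectionNumber T ℓ : ZMod p) - m)
    {α β : K} (h : α ≠ 0 ∨ β ≠ 0) (hd : affineLines d = Set.range (affineLine α β h))
    {k : ℕ} (hk : k < Fintype.card K - 1) :
    (ZMod.castHom (dvd_refl p) K c)⁻¹ * (T.map fun P => (α * P.1 + β * P.2) ^ k).sum =
      ∑ s, (pencilWeight (renitentLines p T d m) w α β h s : K) * s ^ k := by
  set φ := ZMod.castHom (dvd_refl p) K
  have hφc : φ c ≠ 0 := (map_ne_zero φ).mpr hc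
  rw [inv_mul_eq_iff_eq_mul₀ hφc, sum_map_pow_eq_sum_intersectionNumber T h, Finset.mul_sum,
    ← sub_eq_zero, ← Finset.sum_sub_distrib]
  -- The zero on the right is rewritten as `m ∑ s ^ k`, so that the identity can be checked for each
  -- `s` separately.
  rw [← mul_zero (φ m), ← FiniteField.sum_pow_lt_card_sub_one K k hk, Finset.mul_sum]
  refine Finset.sum_congr rfl fun s _ => ?_
  have key : (intersectionNumber T (affineLine α β h s) : K) -
      φ c * (pencilWeight (renitentLines p T d m) w α β h s : K) = φ m := by
    rw [pencilWeight]
    split_ifs with hs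
    · have := congrArg φ (hw _ hs)
      rw [map_mul, map_sub, map_natCast, map_natCast] at this
      rw [this, sub_sub_cancel]
    · have hs' : (intersectionNumber T (affineLine α β h s) : ZMod p) = m := by
        by_contra hne
        exact hs ⟨hd ▸ Set.mem_range_self s, hne⟩
      rw [← hs', map_natCast, Nat.cast_zero, mul_zero, sub_zero]
  rw [← key]
  ring

end PowerSums

/-! ### Nonvanishing and multiplicities -/

section Multiplicity

variable [Fintype K] {T : Multiset (K × K)} {c α β : K} {W : K → ℕ} {n : ℕ}

/-- Setting `X = α`, `Y = β` leaves a product of monic linear factors in `Z`. -/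
lemma envelopeForm_ne_zero (hW : ∑ y, W y = n) (hn : ∀ k, k < n → ((k + 1 : ℕ) : K) ≠ 0)
    (hpow : ∀ k ≤ n,
      c⁻¹ * (T.map fun P => (α * P.1 + β * P.2) ^ k).sum = ∑ y, (W y : K) * y ^ k) :
    envelopeForm T c n ≠ 0 := by
  subst hW
  intro h0
  have h := aeval_envelopeForm hn hpow (1 : Polynomial K)
    ![Polynomial.C α, Polynomial.C β, Polynomial.X] (by simp) (by simp)
  rw [h0, map_zero] at h
  refine Finset.prod_ne_zero_iff.mpr (fun y _ => pow_ne_zero _ ?_) h.symm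
  simpa using Polynomial.X_add_C_ne_zero y

lemma eval_rep_envelopeForm (hW : ∑ y, W y = n) (hn : ∀ k, k < n → ((k + 1 : ℕ) : K) ≠ 0)
    (hpow : ∀ k ≤ n,
      c⁻¹ * (T.map fun P => (α * P.1 + β * P.2) ^ k).sum = ∑ y, (W y : K) * y ^ k)
    (h : α ≠ 0 ∨ β ≠ 0) {s : K} (hs : W s ≠ 0) :
    MvPolynomial.eval (affineLine α β h s).rep (envelopeForm T c n) = 0 := by
  subst hW
  obtain ⟨u, -, h0, h1, h2⟩ := exists_rep_affineLine h s
  rw [← MvPolynomial.aeval_eq_eval, aeval_envelopeForm hn hpow u _ h0 h1]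
  refine Finset.prod_eq_zero (Finset.mem_univ s) ?_
  rw [h2, Algebra.algebraMap_self_apply, mul_neg, neg_add_cancel, zero_pow hs]

/-- On the pencil the form is a product of powers of linear polynomials in `t`, one for each `y`.
Only the one for `y = s` vanishes at `t = 0`, and it does so to order one. -/
lemma emultiplicity_restrict_envelopeForm (hW : ∑ y, W y = n)
    (hn : ∀ k, k < n → ((k + 1 : ℕ) : K) ≠ 0)
    (hpow : ∀ k ≤ n,
      c⁻¹ * (T.map fun P => (α * P.1 + β * P.2) ^ k).sum = ∑ y, (W y : K) * y ^ k)
    (h : α ≠ 0 ∨ β ≠ 0) (s : K) (E : AlgebraicEnvelope K n) (hE : E.form = envelopeForm T c n)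
    {ℓ : Line K} {μ : K} (hℓ0 : ℓ.rep 0 = μ * α) (hℓ1 : ℓ.rep 1 = μ * β)
    (hℓ : ℓ ≠ affineLine α β h s) :
    emultiplicity Polynomial.X (E.restrict (affineLine α β h s) ℓ) = (W s : ℕ∞) := by
  classical
  subst hW
  obtain ⟨u, hu, h0, h1, h2⟩ := exists_rep_affineLine h s
  -- This is the coefficient of `t` in the factor for `s`; it vanishes only if the second line
  -- equals the first. The case `μ = 0`, the line at infinity, is included.
  have hs : ℓ.rep 2 + μ * s ≠ 0 := by
    intro h0
    have hℓ2 : ℓ.rep 2 = μ * -s := by linear_combination h0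
    exact hℓ (eq_affineLine h hℓ0 hℓ1 hℓ2)
  rw [AlgebraicEnvelope.restrict, hE, aeval_envelopeForm hn hpow
    (Polynomial.C u + Polynomial.X * Polynomial.C μ)]
  rotate_left
  · simp only [h0, hℓ0, map_mul, Polynomial.algebraMap_eq]
    ring
  · simp only [h1, hℓ1, map_mul, Polynomial.algebraMap_eq]
    ring
  rw [Finset.emultiplicity_prod Polynomial.prime_X, Finset.sum_eq_single s]
  · have hfac : Polynomial.C ((affineLine α β h s).rep 2) + Polynomial.X * Polynomial.C (ℓ.rep 2) +
        (Polynomial.C u + Polynomial.X * Polynomial.C μ) * algebraMap K (Polynomial K) s =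
        Polynomial.X * Polynomial.C (ℓ.rep 2 + μ * s) := by
      rw [h2]
      simp only [map_mul, map_add, map_neg, Polynomial.algebraMap_eq]
      ring
    rw [hfac, mul_pow, emultiplicity_mul Polynomial.prime_X,
      emultiplicity_pow_self_of_prime Polynomial.prime_X, ← Polynomial.C_pow,
      emultiplicity_eq_zero.mpr, add_zero]
    rw [Polynomial.X_dvd_iff, Polynomial.coeff_C_zero]
    exact pow_ne_zero _ hs
  · intro y _ hy
    rw [emultiplicity_eq_zero]
    intro hdvd
    have := Polynomial.prime_X.dvd_of_dvd_pow hdvd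
    rw [Polynomial.X_dvd_iff, Polynomial.coeff_zero_eq_eval_zero] at this
    simp only [Polynomial.eval_add, Polynomial.eval_mul, Polynomial.eval_C, Polynomial.eval_X,
      Polynomial.algebraMap_eq, h2, zero_mul, add_zero] at this
    refine hy (mul_left_cancel₀ hu ?_)
    linear_combination this
  · simp

end Multiplicity

end RenitentLines

/-! ### The theorem -/

theorem theorem2p2 {K : Type*} [Field K] [Fintype K] (p : ℕ) [Fact p.Prime] [CharP K p]
    (T : Multiset (K × K)) (lam : ℕ) (hlam : 2 * lam ≤ Fintype.card K - 1)
    (F : Set (RenitentLines.Point K))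
    (hF : ∀ d ∈ F, RenitentLines.IsUniformDirection p T (Fintype.card K - lam) d)
    (m : RenitentLines.Point K → ZMod p)
    (hm : ∀ d ∈ F, RenitentLines.IsTypicalNumber p T (Fintype.card K - lam) d (m d))
    (hne : ∀ d ∈ F, (RenitentLines.renitentLines p T d (m d)).Nonempty)
    (c : ZMod p) (hc : c ≠ 0)
    (w : RenitentLines.Line K → ℕ)
    (hw : ∀ d ∈ F, ∀ ℓ ∈ RenitentLines.renitentLines p T d (m d),
      1 ≤ w ℓ ∧ w ℓ ≤ p - 1 ∧
        c * (w ℓ : ZMod p) = (RenitentLines.intersectionNumber T ℓ : ZMod p) - m d)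
    (hsum : ∀ d ∈ F, (∑ᶠ ℓ ∈ RenitentLines.renitentLines p T d (m d), w ℓ) ≤
      min (Fintype.card K - 2) (p - 1)) :
    ∃ Λ : ℕ,
      (∀ d ∈ F, (∑ᶠ ℓ ∈ RenitentLines.renitentLines p T d (m d), w ℓ) = Λ) ∧
      ∃ E : RenitentLines.AlgebraicEnvelope K Λ,
        ∀ d ∈ F, ∀ ℓ ∈ RenitentLines.renitentLines p T d (m d),
          E.Contains ℓ ∧ E.HasPencilMultiplicity d ℓ (w ℓ) := by
  rcases F.eq_empty_or_nonempty with rfl | ⟨d₀, hd₀⟩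
  -- Without directions, the nonzero constant of class 0 serves.
  · exact ⟨0, by simp, ⟨1, one_ne_zero, MvPolynomial.isHomogeneous_one _ _⟩, by simp⟩
  have hp := (Fact.out : p.Prime).two_le
  have hq := Fintype.one_lt_card (α := K)
  set φ := ZMod.castHom (dvd_refl p) K
  set n := ∑ᶠ ℓ ∈ RenitentLines.renitentLines p T d₀ (m d₀), w ℓ
  have hpencil : ∀ d ∈ F, ∃ (α β : K) (h : α ≠ 0 ∨ β ≠ 0),
      (∀ ℓ : RenitentLines.Line K, d ∈ ℓ ↔ ∃ u, ℓ.rep 0 = u * α ∧ ℓ.rep 1 = u * β) ∧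
      RenitentLines.affineLines d = Set.range (RenitentLines.affineLine α β h) ∧
      ∑ᶠ ℓ ∈ RenitentLines.renitentLines p T d (m d), w ℓ = ∑ s,
        RenitentLines.pencilWeight (RenitentLines.renitentLines p T d (m d)) w α β h s ∧
      ∀ k < Fintype.card K - 1, (φ c)⁻¹ * (T.map fun P => (α * P.1 + β * P.2) ^ k).sum =
        ∑ s, (RenitentLines.pencilWeight
          (RenitentLines.renitentLines p T d (m d)) w α β h s : K) * s ^ k := by
    intro d hd
    obtain ⟨α, β, h, hmem, hlines⟩ := RenitentLines.exists_pencil_coordinates (hF d hd).1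
    exact ⟨α, β, h, hmem, hlines,
      RenitentLines.finsum_eq_sum_pencilWeight h (hlines ▸ fun ℓ hℓ => hℓ.1),
      fun k hk => RenitentLines.inv_mul_sum_map_pow_eq hc (fun ℓ hℓ => (hw d hd ℓ hℓ).2.2) h
        hlines hk⟩
  have hcast : ∀ d ∈ F, (φ c)⁻¹ * (T.card : K) =
      ((∑ᶠ ℓ ∈ RenitentLines.renitentLines p T d (m d), w ℓ : ℕ) : K) := by
    intro d hd
    obtain ⟨α, β, h, -, -, hsum', hpow⟩ := hpencil d hd
    -- For `k = 0` the power sums count `T` and the total weight.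
    simpa [hsum'] using hpow 0 (by omega)
  have hconst : ∀ d ∈ F, ∑ᶠ ℓ ∈ RenitentLines.renitentLines p T d (m d), w ℓ = n := by
    intro d hd
    have hmod := (CharP.natCast_eq_natCast K p).mp ((hcast d hd).symm.trans (hcast d₀ hd₀))
    have h1 := (hsum d hd).trans (min_le_right _ _)
    have h2 := (hsum d₀ hd₀).trans (min_le_right _ _)
    exact Nat.ModEq.eq_of_lt_of_lt hmod (by omega) (by omega)
  have hnq : n ≤ Fintype.card K - 2 := (hsum d₀ hd₀).trans (min_le_left _ _)
  have hnp : n ≤ p - 1 := (hsum d₀ hd₀).trans (min_le_right _ _)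
  -- The divisors in Newton's recursion are at most `n ≤ p - 1`, hence prime to `p`.
  have hn : ∀ k, k < n → ((k + 1 : ℕ) : K) ≠ 0 := fun k hk h =>
    absurd (Nat.le_of_dvd k.succ_pos ((CharP.cast_eq_zero_iff K p _).mp h)) (by omega)
  have hform : RenitentLines.envelopeForm T (φ c) n ≠ 0 := by
    obtain ⟨α, β, h, -, -, hsum', hpow⟩ := hpencil d₀ hd₀
    exact RenitentLines.envelopeForm_ne_zero hsum'.symm hn fun k hk => hpow k (by omega)
  refine ⟨n, hconst, ⟨RenitentLines.envelopeForm T (φ c) n, hform,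
    RenitentLines.isHomogeneous_envelopeForm T (φ c) n⟩, fun d hd ℓ hℓ => ?_⟩
  obtain ⟨α, β, h, hmem, hlines, hsum', hpow⟩ := hpencil d hd
  rw [hconst d hd] at hsum'
  have hpow' := fun k (hk : k ≤ n) => hpow k (by omega)
  obtain ⟨s, rfl⟩ : ℓ ∈ Set.range (RenitentLines.affineLine α β h) := hlines ▸ hℓ.1
  have hweight : RenitentLines.pencilWeight (RenitentLines.renitentLines p T d (m d)) w α β h s =
      w (RenitentLines.affineLine α β h s) := if_pos hℓ
  refine ⟨RenitentLines.eval_rep_envelopeForm hsum'.symm hn hpow' h ?_, hℓ.1.1,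
    fun ℓ' hℓ' hne' => ?_⟩
  · rw [hweight]
    exact Nat.one_le_iff_ne_zero.mp (hw d hd _ hℓ).1
  · obtain ⟨μ, h0, h1⟩ := (hmem ℓ').mp hℓ'
    rw [← hweight]
    exact RenitentLines.emultiplicity_restrict_envelopeForm hsum'.symm hn hpow' h s _ rfl h0 h1
      hne'
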